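/- Let $\Delta\subset\mathbb{R}^2=\mathbb{C}$ be the triangle with vertices $A_1=(0,0)$, $A_2=(1,0)$, $A_3=(1/2,\sqrt3/2)$, let $p_1,p_2,p_3>0$ with $p_1+p_2+p_3<1$, and let $S_k(z)=p_k(z-A_k)+A_k$ $(k=1,2,3)$ be the homothety with centre $A_k$ and ratio $p_k$. An attractor of a finite system of maps $\{T_i\}$ of the plane is a non-empty compact set $E$ with $E=\bigcup_i T_i(E)$. Let $K'$ be the attractor of $\{S_1,S_2,S_3\}$ (a Cantor set). Write $S_{ij}=S_i\circ S_j$, and let $[X Y]$ be the closed segment with endpoints $X,Y$. Let $B_1,B_2,B_3$ be the vertices of an equilateral triangle such that $$B_1\in K'\cap S_{12}([A_2A_3]),\qquad B_2\in K'\cap S_{23}([A_1A_3]),\qquad B_3\in K'\cap S_{31}([A_1A_2]),$$ and let $S_0$ be the similarity of the plane with $S_0(A_k)=B_k$ for $k=1,2,3$. Then the system $\{S_0,S_1,S_2,S_3\}$ has a unique attractor $K$, and $K$ is a dendrite, that is, a non-empty, compact, connected and locally connected set that contains no simple closed curve. -/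

import Mathlib

open Set

noncomputable section

/-- A set `K` is an *attractor* of the family of maps `S` if it is non-empty, compact and
satisfies `K = ⋃ i, S i (K)`. -/
def IsAttractor {ι X : Type*} [TopologicalSpace X] (S : ι → X → X) (K : Set X) : Prop :=
  K.Nonempty ∧ IsCompact K ∧ K = ⋃ i, S i '' K

/-- A subset of a metric space is a *dendrite* if it is a locally connected continuum (a compact,
connected, non-empty set, locally connected in its own topology) that contains no simple closed
curve. A simple closed curve is the image of the unit circle under an injective continuous map
(by compactness such a map is a homeomorphism onto its image). -/
def IsDendrite {X : Type*} [MetricSpace X] (K : Set X) : Prop :=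
  IsCompact K ∧ IsConnected K ∧ LocallyConnectedSpace K ∧
    ¬ ∃ f : Circle → X, Continuous f ∧ Function.Injective f ∧ range f ⊆ K

/-! The plane is `ℂ`; the triangle `Δ` has the vertices `(0, 0)`, `(1, 0)`, `(1/2, √3/2)`. -/

/-- The vertex `A₁ = (0, 0)`. -/
def A₁ : ℂ := 0

/-- The vertex `A₂ = (1, 0)`. -/
def A₂ : ℂ := 1

/-- The vertex `A₃ = (1/2, √3/2)`. -/
def A₃ : ℂ := ⟨1 / 2, Real.sqrt 3 / 2⟩

/-- `S₁ z = p₁ z`, the homothety with centre `A₁` and ratio `p₁`. -/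
def S₁ (p₁ : ℝ) : ℂ → ℂ := AffineMap.homothety A₁ p₁

/-- `S₂ z = p₂ z - p₂ + 1`, the homothety with centre `A₂` and ratio `p₂`. -/
def S₂ (p₂ : ℝ) : ℂ → ℂ := AffineMap.homothety A₂ p₂

/-- `S₃ z = p₃ z - p₃ A₃ + A₃`, the homothety with centre `A₃` and ratio `p₃`. -/
def S₃ (p₃ : ℝ) : ℂ → ℂ := AffineMap.homothety A₃ p₃

end

/-!
The four pieces of an attractor `K` of `{S₀, S₁, S₂, S₃}` form a star. In barycentric coordinates,
the corner triangle `S_k(Δ)` is the part of `Δ` where the `k`-th coordinate is at least `1 - p_k`,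
and `p₁ + p₂ + p₃ < 1` makes the three corners disjoint. The point `B_k` has `k`-th coordinate
exactly `1 - p_k`, whereas the two other vertices of `S₀(Δ)` lie outside the `k`-th corner; so
`S₀(Δ)` touches this corner only in `B_k`. As `B_k` belongs to `K'`, and `K' ⊆ K`, this point does
lie in both pieces: `S₀(K)` meets `S_k(K)` exactly in `B_k = S₀(A_k)`
(`eq_triangleVertex_of_le_baryCoord`, `starSystem_unique_attractor_and_isDendrite`).

The side of `S₀(Δ)` is shorter than that of `Δ` (`dilation_ratio_lt_one`), so all four maps are
contractions. Hutchinson's theorem (`exists_isAttractor`) gives an attractor, and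
`IsAttractor.subset_of_mapsTo` its uniqueness and the inclusions `K ⊆ Δ` and `K' ⊆ K`.

A star-shaped attractor is a dendrite (`IsAttractor.isDendrite_of_star`). It is connected because
its pieces are linked, on every scale; it is locally connected because it is a finite union of
arbitrarily small connected copies of itself. A simple closed curve cannot pass from one piece to
another through a single point, so it lies in one piece; undoing that similarity gives a larger
simple closed curve in `K`, and iterating contradicts the boundedness of `K`.
-/

open scoped NNReal

/-! ### Attractors of finite systems of contractions -/

section Attractor

variable {ι X : Type*} [MetricSpace X] {S : ι → X → X} {K : Set X} {r : ℝ≥0}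

theorem IsAttractor.mapsTo (hK : IsAttractor S K) (i : ι) : MapsTo (S i) K K := by
  intro x hx
  rw [hK.2.2]
  exact mem_iUnion.2 ⟨i, x, hx, rfl⟩

theorem IsAttractor.exists_mem_image (hK : IsAttractor S K) {x : X} (hx : x ∈ K) :
    ∃ i, x ∈ S i '' K := by
  rw [hK.2.2] at hx
  exact mem_iUnion.1 hx

/-- The attractor lies in every non-empty closed set that all the maps send into itself: the
largest distance from a point of the attractor to the closed set is at most `r` times itself. -/
theorem IsAttractor.subset_of_mapsTo (hK : IsAttractor S K) (hS : ∀ i, LipschitzWith r (S i))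
    (hr : r < 1) {C : Set X} (hC : IsClosed C) (hne : C.Nonempty)
    (hm : ∀ i, MapsTo (S i) C C) : K ⊆ C := by
  obtain ⟨x, hx, hmax⟩ := hK.2.1.exists_isMaxOn hK.1
    (Metric.continuous_infDist_pt C).continuousOn
  have key : Metric.infDist x C ≤ r * Metric.infDist x C := by
    obtain ⟨i, y, hy, rfl⟩ := hK.exists_mem_image hx
    have hle : Metric.infDist (S i y) C ≤ r * Metric.infDist y C := by
      refine le_of_forall_pos_lt_add fun ε hε => ?_
      obtain ⟨c, hc, hlt⟩ := (Metric.infDist_lt_iff hne).1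
        (lt_add_of_pos_right (Metric.infDist y C) hε)
      have hr1 : (r : ℝ) < 1 := hr
      calc Metric.infDist (S i y) C ≤ dist (S i y) (S i c) :=
            Metric.infDist_le_dist_of_mem (hm i hc)
        _ ≤ r * dist y c := (hS i).dist_le_mul y c
        _ ≤ r * (Metric.infDist y C + ε) := by gcongr
        _ < r * Metric.infDist y C + ε := by nlinarith
    exact hle.trans (mul_le_mul_of_nonneg_left (hmax hy) r.2)
  have hr1 : (r : ℝ) < 1 := hr
  have h0 : Metric.infDist x C ≤ 0 := by
    by_contra h
    nlinarith
  intro y hy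
  rw [hC.mem_iff_infDist_zero hne]
  exact le_antisymm ((hmax hy).trans h0) Metric.infDist_nonneg

theorem IsAttractor.unique {L : Set X} (hK : IsAttractor S K) (hL : IsAttractor S L)
    (hS : ∀ i, LipschitzWith r (S i)) (hr : r < 1) : K = L :=
  (hK.subset_of_mapsTo hS hr hL.2.1.isClosed hL.1 hL.mapsTo).antisymm
    (hL.subset_of_mapsTo hS hr hK.2.1.isClosed hK.1 hK.mapsTo)

/-- Hutchinson's theorem: `K ↦ ⋃ i, S i '' K` is a contraction for the Hausdorff distance on the
complete space of non-empty compact sets. -/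
theorem exists_isAttractor [Finite ι] [Nonempty ι] [CompleteSpace X] [Nonempty X]
    (hS : ∀ i, LipschitzWith r (S i)) (hr : r < 1) : ∃ K, IsAttractor S K := by
  let F : TopologicalSpace.NonemptyCompacts X → TopologicalSpace.NonemptyCompacts X := fun K =>
    ⟨⟨⋃ i, S i '' K, isCompact_iUnion fun i => K.isCompact.image (hS i).continuous⟩,
      nonempty_iUnion.2 ⟨Classical.arbitrary ι, K.nonempty.image _⟩⟩
  have hF : ContractingWith r F := by
    refine ⟨hr, fun K L => ?_⟩
    change Metric.hausdorffEDist (⋃ i, S i '' (K : Set X)) (⋃ i, S i '' (L : Set X)) ≤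
      r * Metric.hausdorffEDist (K : Set X) L
    refine Metric.hausdorffEDist_iUnion_le.trans (iSup_le fun i => ?_)
    have main : ∀ K L : TopologicalSpace.NonemptyCompacts X, ∀ x ∈ S i '' (K : Set X),
        Metric.infEDist x (S i '' (L : Set X)) ≤
          r * Metric.hausdorffEDist (K : Set X) L := by
      rintro K L _ ⟨x, hx, rfl⟩
      obtain ⟨y, hy, hxy⟩ := L.isCompact.exists_infEDist_eq_edist L.nonempty x
      calc Metric.infEDist (S i x) (S i '' (L : Set X)) ≤ edist (S i x) (S i y) :=
            Metric.infEDist_le_edist_of_mem (mem_image_of_mem _ hy)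
        _ ≤ r * edist x y := hS i x y
        _ ≤ r * Metric.hausdorffEDist (K : Set X) L := by
            gcongr
            rw [← hxy]
            exact Metric.infEDist_le_hausdorffEDist_of_mem hx
    refine Metric.hausdorffEDist_le_of_infEDist (main K L) fun x hx => ?_
    rw [Metric.hausdorffEDist_comm]
    exact main L K x hx
  have : Nonempty (TopologicalSpace.NonemptyCompacts X) := ⟨{Classical.arbitrary X}⟩
  let K := ContractingWith.fixedPoint F hF
  have hK : F K = K := hF.fixedPoint_isFixedPt
  exact ⟨K, K.nonempty, K.isCompact, (congrArg (fun L : TopologicalSpace.NonemptyCompacts X =>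
    (L : Set X)) hK).symm⟩

/-! ### Connectedness and local connectedness of star-shaped attractors -/

/-- If one piece `S o '' K` of the attractor meets all the others, the attractor is connected. A
part of `K` that is closed under steps of length `r ^ n * diam K` is empty or all of `K`, by
induction on `n`: the step length scales down with the pieces, and the pieces are linked. -/
theorem IsAttractor.isConnected_of_star (hK : IsAttractor S K)
    (hS : ∀ i, LipschitzWith r (S i)) (hr : r < 1) (o : ι)
    (ho : ∀ i, (S i '' K ∩ S o '' K).Nonempty) : IsConnected K := by
  have chain : ∀ (n : ℕ) (u : Set X),
      (∀ x ∈ K, ∀ y ∈ K, dist x y ≤ r ^ n * Metric.diam K → (x ∈ u ↔ y ∈ u)) →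
      ∀ x ∈ K, ∀ y ∈ K, (x ∈ u ↔ y ∈ u) := by
    intro n
    induction n with
    | zero =>
      intro u hu x hx y hy
      exact hu x hx y hy (by simpa using Metric.dist_le_diam_of_mem hK.2.1.isBounded hx hy)
    | succ n ih =>
      intro u hu
      have hpiece : ∀ i, ∀ x ∈ S i '' K, ∀ y ∈ S i '' K, (x ∈ u ↔ y ∈ u) := by
        rintro i _ ⟨x, hx, rfl⟩ _ ⟨y, hy, rfl⟩
        refine ih (S i ⁻¹' u) (fun a ha b hb hab => ?_) x hx y hy
        refine hu _ (hK.mapsTo i ha) _ (hK.mapsTo i hb) (((hS i).dist_le_mul a b).trans ?_)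
        rw [pow_succ', mul_assoc]
        gcongr
      have hcentre : ∀ x ∈ K, ∀ y ∈ S o '' K, (x ∈ u ↔ y ∈ u) := by
        intro x hx y hy
        obtain ⟨i, hi⟩ := hK.exists_mem_image hx
        obtain ⟨b, hbi, hbo⟩ := ho i
        exact (hpiece i x hi b hbi).trans (hpiece o b hbo y hy)
      intro x hx y hy
      obtain ⟨b, -, hbo⟩ := ho o
      exact (hcentre x hx b hbo).trans (hcentre y hy b hbo).symm
  refine ⟨hK.1, isPreconnected_closed_iff.2 fun u v hu hv hcov hKu hKv => ?_⟩
  by_contra hne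
  have hdisj : Disjoint (K ∩ u) (K ∩ v) := disjoint_left.2 fun x hxu hxv =>
    hne ⟨x, hxu.1, hxu.2, hxv.2⟩
  obtain ⟨δ, hδ, hsep⟩ := Metric.exists_pos_forall_lt_edist (hK.2.1.inter_right hu)
    (hK.2.1.isClosed.inter hv) hdisj
  have hlim : Filter.Tendsto (fun n : ℕ => (r : ℝ) ^ n * Metric.diam K) Filter.atTop (nhds 0) := by
    simpa using (tendsto_pow_atTop_nhds_zero_of_lt_one r.2 hr).mul_const (Metric.diam K)
  obtain ⟨n, hn⟩ := (hlim.eventually_lt_const (show (0 : ℝ) < δ from hδ)).exists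
  have hfar : ∀ x ∈ K, ∀ y ∈ K, dist x y ≤ r ^ n * Metric.diam K → x ∈ u → y ∈ u := by
    intro x hx y hy hxy hxu
    rcases hcov hy with hyu | hyv
    · exact hyu
    · have h1 := hsep x ⟨hx, hxu⟩ y ⟨hy, hyv⟩
      rw [edist_nndist, ENNReal.coe_lt_coe, ← NNReal.coe_lt_coe, coe_nndist] at h1
      linarith
  obtain ⟨a, haK, hau⟩ := hKu
  obtain ⟨b, hbK, hbv⟩ := hKv
  refine hne ⟨b, hbK, (chain n u (fun x hx y hy hxy => ⟨hfar x hx y hy hxy,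
    hfar y hy x hx (by rwa [dist_comm])⟩) a haK b hbK).1 hau, hbv⟩

/-- A set that is, for every `ε > 0`, a finite union of closed connected sets of diameter at most
`ε` is locally connected: the union of those of the sets that contain `x` is a small connected
neighbourhood of `x`. -/
theorem locallyConnectedSpace_of_finite_cover
    (h : ∀ ε > 0, ∃ 𝓕 : Set (Set X), 𝓕.Finite ∧ ⋃₀ 𝓕 = K ∧
      ∀ F ∈ 𝓕, IsClosed F ∧ IsPreconnected F ∧ ∀ x ∈ F, ∀ y ∈ F, dist x y ≤ ε) :
    LocallyConnectedSpace K := by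
  refine locallyConnectedSpace_iff_connected_subsets.2 fun x U hU => ?_
  obtain ⟨ε, hε, hball⟩ := Metric.mem_nhds_iff.1 hU
  obtain ⟨𝓕, hfin, hcov, h𝓕⟩ := h (ε / 2) (half_pos hε)
  have hV : ⋃₀ {F ∈ 𝓕 | (x : X) ∈ F} ⊆ K :=
    (sUnion_subset_sUnion (sep_subset _ _)).trans hcov.subset
  refine ⟨(↑) ⁻¹' (⋃₀ {F ∈ 𝓕 | (x : X) ∈ F}), ?_, ?_, ?_⟩
  · have hclosed : IsClosed (⋃₀ {F ∈ 𝓕 | (x : X) ∉ F}) := by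
      rw [sUnion_eq_biUnion]
      exact (hfin.subset (sep_subset _ _)).isClosed_biUnion fun F hF => (h𝓕 F hF.1).1
    have hx : (x : X) ∉ ⋃₀ {F ∈ 𝓕 | (x : X) ∉ F} := by
      rintro ⟨F, hF, hxF⟩
      exact hF.2 hxF
    filter_upwards [(hclosed.isOpen_compl.preimage continuous_subtype_val).mem_nhds hx] with y hy
    obtain ⟨F, hF, hyF⟩ := mem_sUnion.1 (hcov.symm ▸ y.2 : (y : X) ∈ ⋃₀ 𝓕)
    by_cases hxF : (x : X) ∈ F
    · exact ⟨F, ⟨hF, hxF⟩, hyF⟩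
    · exact absurd ⟨F, ⟨hF, hxF⟩, hyF⟩ hy
  · rw [← Topology.IsInducing.subtypeVal.isPreconnected_image, Subtype.image_preimage_coe,
      inter_eq_right.2 hV]
    exact isPreconnected_sUnion (x : X) _ (fun F hF => hF.2) fun F hF => (h𝓕 F hF.1).2.1
  · rintro y ⟨F, hF, hyF⟩
    refine hball ?_
    rw [Metric.mem_ball, Subtype.dist_eq]
    linarith [(h𝓕 F hF.1).2.2 y hyF x hF.2]

theorem IsAttractor.locallyConnectedSpace [Finite ι] (hK : IsAttractor S K)
    (hS : ∀ i, LipschitzWith r (S i)) (hr : r < 1) (hconn : IsPreconnected K) :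
    LocallyConnectedSpace K := by
  have pieces : ∀ n : ℕ, ∃ 𝓕 : Set (Set X), 𝓕.Finite ∧ ⋃₀ 𝓕 = K ∧ ∀ F ∈ 𝓕, IsCompact F ∧
      IsPreconnected F ∧ ∀ x ∈ F, ∀ y ∈ F, dist x y ≤ r ^ n * Metric.diam K := by
    intro n
    induction n with
    | zero =>
      refine ⟨{K}, finite_singleton K, sUnion_singleton K, ?_⟩
      rintro F rfl
      exact ⟨hK.2.1, hconn, fun x hx y hy => by
        simpa using Metric.dist_le_diam_of_mem hK.2.1.isBounded hx hy⟩
    | succ n ih =>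
      obtain ⟨𝓕, hfin, hcov, h𝓕⟩ := ih
      refine ⟨⋃ i, image (S i) '' 𝓕, finite_iUnion fun i => hfin.image _, ?_, ?_⟩
      · rw [sUnion_iUnion]
        conv_rhs => rw [hK.2.2]
        refine iUnion_congr fun i => ?_
        rw [← hcov, image_sUnion]
      · intro F hF
        obtain ⟨i, G, hG, rfl⟩ := mem_iUnion.1 hF
        obtain ⟨hcomp, hpre, hdist⟩ := h𝓕 G hG
        refine ⟨hcomp.image (hS i).continuous, hpre.image _ (hS i).continuous.continuousOn, ?_⟩
        rintro _ ⟨x, hx, rfl⟩ _ ⟨y, hy, rfl⟩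
        refine ((hS i).dist_le_mul x y).trans ?_
        rw [pow_succ', mul_assoc]
        exact mul_le_mul_of_nonneg_left (hdist x hx y hy) r.2
  refine locallyConnectedSpace_of_finite_cover fun ε hε => ?_
  have hlim : Filter.Tendsto (fun n : ℕ => (r : ℝ) ^ n * Metric.diam K) Filter.atTop (nhds 0) := by
    simpa using (tendsto_pow_atTop_nhds_zero_of_lt_one r.2 hr).mul_const (Metric.diam K)
  obtain ⟨n, hn⟩ := (hlim.eventually_lt_const hε).exists
  obtain ⟨𝓕, hfin, hcov, h𝓕⟩ := pieces n
  exact ⟨𝓕, hfin, hcov, fun F hF => ⟨(h𝓕 F hF).1.isClosed, (h𝓕 F hF).2.1, fun x hx y hy =>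
    ((h𝓕 F hF).2.2 x hx y hy).trans hn.le⟩⟩

/-! ### Simple closed curves in star-shaped attractors -/

/-- A simple closed curve in a finite union of closed sets, each of which meets the central set
`P o` in at most one point and is disjoint from the others, lies in one of these sets: removing
one point does not disconnect the curve. -/
theorem exists_range_subset_of_star [Finite ι] {P : ι → Set X} (hP : ∀ i, IsClosed (P i)) (o : ι)
    (b : ι → X) (ho : ∀ i, i ≠ o → P i ∩ P o = {b i})
    (hd : ∀ i j, i ≠ o → j ≠ o → i ≠ j → Disjoint (P i) (P j))
    {f : Circle → X} (hf : Continuous f) (hinj : Function.Injective f)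
    (hsub : range f ⊆ ⋃ i, P i) : ∃ i, range f ⊆ P i := by
  by_contra! hno
  have hb : ∀ i, i ≠ o → b i ∈ P i ∩ P o := fun i hi => (ho i hi).symm ▸ mem_singleton (b i)
  have hout : ∀ i, i ≠ o → ∀ z, f z ∈ P i → f z = b i := by
    intro i hi z hz
    by_contra hzb
    have hT : IsPreconnected {z | f z ≠ b i} := by
      by_cases hc : ∃ c, f c = b i
      · obtain ⟨c, hc⟩ := hc
        have : {z | f z ≠ b i} = {c}ᶜ := by
          ext z
          simp [← hc, hinj.eq_iff]
        rw [this]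
        exact (Circle.isPathConnected_compl_singleton c).isConnected.isPreconnected
      · have : {z | f z ≠ b i} = univ := eq_univ_of_forall fun z hz => hc ⟨z, hz⟩
        rw [this]
        exact isPreconnected_univ
    obtain ⟨_, ⟨w, rfl⟩, hw⟩ := not_subset.1 (hno i)
    have hclosed : IsClosed (⋃ j ∈ {j | j ≠ i}, P j) :=
      (toFinite _).isClosed_biUnion fun j _ => hP j
    have hrest : ∀ z, f z ∉ P i → f z ∈ ⋃ j ∈ {j | j ≠ i}, P j := by
      intro z hz
      obtain ⟨j, hj⟩ := mem_iUnion.1 (hsub (mem_range_self z))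
      exact mem_biUnion (show j ≠ i from fun h => hz (h ▸ hj)) hj
    obtain ⟨v, hv, hv1, hv2⟩ := isPreconnected_closed_iff.1 hT (f ⁻¹' P i)
      (f ⁻¹' ⋃ j ∈ {j | j ≠ i}, P j) ((hP i).preimage hf) (hclosed.preimage hf)
      (fun z _ => (em (f z ∈ P i)).imp id (hrest z)) ⟨z, hzb, hz⟩
      ⟨w, fun h => hw (h ▸ (hb i hi).1), hrest w hw⟩
    obtain ⟨j, hji, hvj⟩ := mem_iUnion₂.1 hv2
    by_cases hjo : j = o
    · subst hjo
      have : f v ∈ P i ∩ P j := ⟨hv1, hvj⟩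
      rw [ho i hi] at this
      exact hv this
    · exact (disjoint_left.1 (hd i j hi hjo (Ne.symm hji)) hv1) hvj
  refine hno o ?_
  rintro _ ⟨z, rfl⟩
  obtain ⟨j, hj⟩ := mem_iUnion.1 (hsub (mem_range_self z))
  by_cases hjo : j = o
  · exact hjo ▸ hj
  · rw [hout j hjo z hj]
    exact (hb j hjo).2

/-- If the pieces of the attractor of a system of similarities form a star, i.e. a central piece
meets each of the others in one point and these are pairwise disjoint, then the attractor
is a dendrite. A simple closed curve in it would lie in one piece, so it would be the image under
a contracting similarity of a larger simple closed curve in the attractor, and so on without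
end. -/
theorem IsAttractor.isDendrite_of_star [Finite ι] (hK : IsAttractor S K) {ρ : ι → ℝ≥0}
    (hρ : ∀ i, ρ i ≠ 0) (hS : ∀ i x y, dist (S i x) (S i y) = ρ i * dist x y)
    (hρr : ∀ i, ρ i ≤ r) (hr : r < 1) (o : ι) (b : ι → X)
    (ho : ∀ i, i ≠ o → S i '' K ∩ S o '' K = {b i})
    (hd : ∀ i j, i ≠ o → j ≠ o → i ≠ j → Disjoint (S i '' K) (S j '' K)) :
    IsDendrite K := by
  have hlip : ∀ i, LipschitzWith r (S i) := fun i => LipschitzWith.of_dist_le_mul fun x y => by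
    rw [hS]
    exact mul_le_mul_of_nonneg_right (hρr i) dist_nonneg
  have hanti : ∀ i, AntilipschitzWith (ρ i)⁻¹ (S i) := fun i =>
    AntilipschitzWith.of_le_mul_dist fun x y => by
      rw [hS, NNReal.coe_inv, inv_mul_cancel_left₀ (NNReal.coe_ne_zero.2 (hρ i))]
  have hconn : IsConnected K := hK.isConnected_of_star hlip hr o fun i => by
    by_cases hi : i = o
    · subst hi
      simpa using hK.1
    · rw [ho i hi]
      exact singleton_nonempty _
  refine ⟨hK.2.1, hconn, hK.locallyConnectedSpace hlip hr hconn.isPreconnected, ?_⟩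
  have small : ∀ (n : ℕ) (f : Circle → X), Continuous f → Function.Injective f → range f ⊆ K →
      dist (f 1) (f (-1)) ≤ r ^ n * Metric.diam K := by
    intro n
    induction n with
    | zero =>
      intro f _ _ hsub
      simpa using Metric.dist_le_diam_of_mem hK.2.1.isBounded
        (hsub (mem_range_self 1)) (hsub (mem_range_self (-1)))
    | succ n ih =>
      intro f hf hinj hsub
      obtain ⟨i, hi⟩ := exists_range_subset_of_star
        (fun i => (hK.2.1.image (hlip i).continuous).isClosed) o b ho hd hf hinj
        (hsub.trans hK.2.2.subset)
      choose g hgK hg using fun z => hi (mem_range_self z)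
      obtain rfl : S i ∘ g = f := funext hg
      have hind : Topology.IsInducing (S i) :=
        ((hanti i).isUniformInducing (hlip i).uniformContinuous).isInducing
      have := ih g (hind.continuous_iff.2 hf) hinj.of_comp (range_subset_iff.2 hgK)
      refine ((hlip i).dist_le_mul _ _).trans ?_
      rw [pow_succ', mul_assoc]
      exact mul_le_mul_of_nonneg_left this r.2
  rintro ⟨f, hf, hinj, hsub⟩
  have hlim : Filter.Tendsto (fun n : ℕ => (r : ℝ) ^ n * Metric.diam K) Filter.atTop (nhds 0) := by
    simpa using (tendsto_pow_atTop_nhds_zero_of_lt_one r.2 hr).mul_const (Metric.diam K)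
  have h0 : dist (f 1) (f (-1)) ≤ 0 := ge_of_tendsto' hlim fun n => small n f hf hinj hsub
  have h1 : (1 : Circle) = -1 := hinj (dist_le_zero.1 h0)
  have h2 : (1 : ℂ) = -1 := by simpa using congrArg (fun z : Circle => (z : ℂ)) h1
  norm_num at h2

end Attractor

/-! ### Barycentric coordinates and the triangle -/

/-- The vertices of the triangle `Δ`, indexed from `0`. -/
noncomputable def triangleVertex : Fin 3 → ℂ := ![A₁, A₂, A₃]

/-- The barycentric coordinates of a point of the plane with respect to `A₁, A₂, A₃`: these are
the real affine functions with value `1` at one vertex and `0` at the two others. -/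
noncomputable def baryCoord (k : Fin 3) (z : ℂ) : ℝ :=
  ![1 - z.re - z.im / √3, z.re - z.im / √3, 2 * z.im / √3] k

/-- The full closed triangle `Δ`, as the set of points with non-negative barycentric
coordinates. -/
def triangle : Set ℂ := {z | ∀ k, 0 ≤ baryCoord k z}

theorem sum_baryCoord (z : ℂ) : ∑ k, baryCoord k z = 1 := by
  simp [Fin.sum_univ_three, baryCoord]
  ring

theorem baryCoord_triangleVertex (k j : Fin 3) :
    baryCoord k (triangleVertex j) = if k = j then 1 else 0 := by
  have h3 : √3 ≠ 0 := by positivity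
  fin_cases k <;> fin_cases j <;> simp [baryCoord, triangleVertex, A₁, A₂, A₃] <;>
    field_simp <;> norm_num

theorem sum_baryCoord_smul (z : ℂ) : ∑ k, baryCoord k z • triangleVertex k = z := by
  have h3 : √3 ≠ 0 := by positivity
  apply Complex.ext <;> simp [Fin.sum_univ_three, baryCoord, triangleVertex, A₁, A₂, A₃] <;>
    field_simp <;> ring

theorem baryCoord_sum_smul (k : Fin 3) (w : Fin 3 → ℝ) (hw : ∑ j, w j = 1) (B : Fin 3 → ℂ) :
    baryCoord k (∑ j, w j • B j) = ∑ j, w j * baryCoord k (B j) := by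
  rw [Fin.sum_univ_three] at hw
  fin_cases k <;> simp [Fin.sum_univ_three, baryCoord]
  · linear_combination -hw
  · ring
  · ring

theorem baryCoord_homothety (k j : Fin 3) (p : ℝ) (z : ℂ) :
    baryCoord k (AffineMap.homothety (triangleVertex j) p z) =
      p * baryCoord k z + (1 - p) * if k = j then 1 else 0 := by
  rw [← baryCoord_triangleVertex]
  fin_cases k <;> simp [AffineMap.homothety_apply, baryCoord] <;> ring

theorem continuous_baryCoord (k : Fin 3) : Continuous (baryCoord k) := by
  unfold baryCoord
  fin_cases k <;> simp <;> fun_prop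

theorem isClosed_triangle : IsClosed triangle := by
  simp only [triangle, ofPred_forall]
  exact isClosed_iInter fun k => isClosed_le continuous_const (continuous_baryCoord k)

theorem triangleVertex_mem_triangle (j : Fin 3) : triangleVertex j ∈ triangle := fun k => by
  rw [baryCoord_triangleVertex]
  split_ifs <;> norm_num

theorem mapsTo_homothety_triangle (j : Fin 3) {p : ℝ} (hp : 0 ≤ p) (hp1 : p ≤ 1) :
    MapsTo (AffineMap.homothety (triangleVertex j) p) triangle triangle := fun z hz k => by
  rw [baryCoord_homothety]
  have := hz k
  have := sub_nonneg.2 hp1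
  split_ifs <;> positivity

/-- Two distinct barycentric coordinates of a point of the triangle add up to at most `1`. -/
theorem baryCoord_add_le {z : ℂ} (hz : z ∈ triangle) {i j : Fin 3} (hij : i ≠ j) :
    baryCoord i z + baryCoord j z ≤ 1 := by
  rw [← sum_baryCoord z, ← Finset.sum_pair (f := fun k => baryCoord k z) hij]
  exact Finset.sum_le_sum_of_subset_of_nonneg (Finset.subset_univ _) fun k _ _ => hz k

theorem dist_sq_eq_baryCoord (z w : ℂ) : dist z w ^ 2 =
    (baryCoord 0 z - baryCoord 0 w) ^ 2 + (baryCoord 1 z - baryCoord 1 w) ^ 2 +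
      (baryCoord 0 z - baryCoord 0 w) * (baryCoord 1 z - baryCoord 1 w) := by
  have h3 : √3 ^ 2 = 3 := Real.sq_sqrt (by norm_num)
  rw [Complex.dist_eq, ← Complex.normSq_eq_norm_sq, Complex.normSq_apply]
  simp [baryCoord]
  field_simp
  ring_nf
  rw [h3]
  ring

theorem dist_homothety_apply (c : ℂ) {p : ℝ} (hp : 0 ≤ p) (z w : ℂ) :
    dist (AffineMap.homothety c p z) (AffineMap.homothety c p w) = p * dist z w := by
  simp only [AffineMap.homothety_apply, vsub_eq_sub, vadd_eq_add, dist_add_right, dist_smul₀,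
    Real.norm_of_nonneg hp, dist_sub_right]

/-- A similarity of the plane preserves barycentric combinations, because an isometry into a
strictly convex space is affine. -/
theorem Dilation.apply_eq_sum_baryCoord (T : ℂ →ᵈ ℂ) (z : ℂ) :
    T z = ∑ k, baryCoord k z • T (triangleVertex k) := by
  have hρ : (Dilation.ratio T : ℝ) ≠ 0 := NNReal.coe_ne_zero.2 (Dilation.ratio_ne_zero T)
  have hiso : Isometry fun z => (Dilation.ratio T : ℝ)⁻¹ • T z := Isometry.of_dist_eq fun x y => by
    rw [dist_smul₀, Dilation.dist_eq, norm_inv, NNReal.norm_eq,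
      inv_mul_cancel_left₀ hρ]
  let φ : ℂ →ᵃ[ℝ] ℂ := hiso.affineIsometryOfStrictConvexSpace.toAffineMap
  have hT : ∀ x, T x = (Dilation.ratio T : ℝ) • (φ.linear x + φ 0) := fun x => by
    have : φ x = φ.linear x + φ 0 := congrFun φ.decomp x
    rw [← this]
    exact (smul_inv_smul₀ hρ (T x)).symm
  have h0 : φ 0 = ∑ k, baryCoord k z • φ 0 := by
    rw [← Finset.sum_smul, sum_baryCoord, one_smul]
  have hlin : φ.linear z = ∑ k, baryCoord k z • φ.linear (triangleVertex k) := by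
    conv_lhs => rw [← sum_baryCoord_smul z]
    simp only [map_sum, map_smul]
  calc T z = (Dilation.ratio T : ℝ) • ∑ k, baryCoord k z • (φ.linear (triangleVertex k) + φ 0) := by
        rw [hT]
        simp only [smul_add, Finset.sum_add_distrib, ← hlin, ← h0]
    _ = ∑ k, baryCoord k z • T (triangleVertex k) := by
        rw [Finset.smul_sum]
        exact Finset.sum_congr rfl fun k _ => by rw [hT, smul_comm]

/-! ### The inscribed triangle -/

section Inscribed

variable {p : Fin 3 → ℝ} {B : Fin 3 → ℂ} {S₀ : ℂ →ᵈ ℂ}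

theorem ratio_add_lt_one (hp0 : ∀ k, 0 < p k) (hp : ∑ k, p k < 1) {i j : Fin 3} (hij : i ≠ j) :
    p i + p j < 1 := by
  rw [← Finset.sum_pair hij]
  exact (Finset.sum_le_sum_of_subset_of_nonneg (Finset.subset_univ _)
    fun k _ _ => (hp0 k).le).trans_lt hp

theorem baryCoord_le_of_ne (hB : ∀ k, B k ∈ triangle) (hBk : ∀ k, baryCoord k (B k) = 1 - p k)
    {j k : Fin 3} (hjk : j ≠ k) : baryCoord j (B k) ≤ p k := by
  linarith [baryCoord_add_le (hB k) hjk, hBk k]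

theorem mapsTo_triangle_of_vertices (hB : ∀ k, B k ∈ triangle)
    (hS₀ : ∀ k, S₀ (triangleVertex k) = B k) : MapsTo S₀ triangle triangle := fun z hz k => by
  rw [Dilation.apply_eq_sum_baryCoord, baryCoord_sum_smul k _ (sum_baryCoord z)]
  exact Finset.sum_nonneg fun j _ => mul_nonneg (hz j) (by rw [hS₀]; exact hB j k)

/-- The inscribed triangle touches the corner `1 - p k ≤ baryCoord k` only in its vertex `B k`,
since `baryCoord k` is smaller than `1 - p k` at its two other vertices. -/
theorem eq_triangleVertex_of_le_baryCoord (hp0 : ∀ k, 0 < p k) (hp : ∑ k, p k < 1)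
    (hB : ∀ k, B k ∈ triangle) (hBk : ∀ k, baryCoord k (B k) = 1 - p k)
    (hS₀ : ∀ k, S₀ (triangleVertex k) = B k) {z : ℂ} (hz : z ∈ triangle) {k : Fin 3}
    (hk : 1 - p k ≤ baryCoord k (S₀ z)) : z = triangleVertex k := by
  rw [Dilation.apply_eq_sum_baryCoord, baryCoord_sum_smul k _ (sum_baryCoord z)] at hk
  simp only [hS₀] at hk
  have hlt : ∀ j, j ≠ k → baryCoord k (B j) < 1 - p k := fun j hj => by
    linarith [baryCoord_le_of_ne hB hBk hj.symm, ratio_add_lt_one hp0 hp hj]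
  have hnonpos : ∀ j ∈ Finset.univ, baryCoord j z * (baryCoord k (B j) - (1 - p k)) ≤ 0 :=
    fun j _ => by
      refine mul_nonpos_of_nonneg_of_nonpos (hz j) ?_
      by_cases hj : j = k
      · rw [hj, hBk, sub_self]
      · exact (sub_neg.2 (hlt j hj)).le
  have hsum : ∑ j, baryCoord j z * (baryCoord k (B j) - (1 - p k)) = 0 := by
    refine le_antisymm (Finset.sum_nonpos hnonpos) ?_
    simp only [mul_sub, Finset.sum_sub_distrib, ← Finset.sum_mul, sum_baryCoord]
    linarith
  have hzero : ∀ j, j ≠ k → baryCoord j z = 0 := fun j hj =>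
    (mul_eq_zero.1 ((Finset.sum_eq_zero_iff_of_nonpos hnonpos).1 hsum j
      (Finset.mem_univ j))).resolve_right (sub_neg.2 (hlt j hj)).ne
  have hone : baryCoord k z = 1 := by
    rw [← sum_baryCoord z]
    exact (Finset.sum_eq_single k (fun j _ hj => hzero j hj) (by simp)).symm
  rw [← sum_baryCoord_smul z, Finset.sum_eq_single k (fun j _ hj => by rw [hzero j hj, zero_smul])
    (by simp), hone, one_smul]

/-- The differences `baryCoord 0 (B 0 - B 1)` and `baryCoord 1 (B 1 - B 0)` lie strictly between
`0` and `1`, so the side of the inscribed triangle is shorter than the unit side of `Δ`. -/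
theorem dilation_ratio_lt_one (hp0 : ∀ k, 0 < p k) (hp : ∑ k, p k < 1)
    (hB : ∀ k, B k ∈ triangle) (hBk : ∀ k, baryCoord k (B k) = 1 - p k)
    (hS₀ : ∀ k, S₀ (triangleVertex k) = B k) : Dilation.ratio S₀ < 1 := by
  have hside : dist (triangleVertex 0) (triangleVertex 1) = 1 := by
    simp [triangleVertex, A₁, A₂]
  have hdist : dist (B 0) (B 1) = Dilation.ratio S₀ := by
    rw [← hS₀, ← hS₀, Dilation.dist_eq, hside, mul_one]
  have h01 := ratio_add_lt_one hp0 hp (show (0 : Fin 3) ≠ 1 by decide)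
  have hu1 := baryCoord_le_of_ne hB hBk (show (0 : Fin 3) ≠ 1 by decide)
  have hv1 := baryCoord_le_of_ne hB hBk (show (1 : Fin 3) ≠ 0 by decide)
  have hu0 := hB 1 0
  have hv0 := hB 0 1
  have hsq := dist_sq_eq_baryCoord (B 0) (B 1)
  rw [hBk 0, hBk 1, hdist] at hsq
  have hp00 := hp0 0
  have hp01 := hp0 1
  have hρ : (Dilation.ratio S₀ : ℝ) ^ 2 < 1 := by
    rw [hsq]
    generalize baryCoord 0 (B 1) = s at *
    generalize baryCoord 1 (B 0) = t at *
    obtain ⟨a, ha⟩ : ∃ a, a = 1 - p 0 - s := ⟨_, rfl⟩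
    obtain ⟨b, hb⟩ : ∃ b, b = 1 - p 1 - t := ⟨_, rfl⟩
    have hb' : t - (1 - p 1) = -b := by rw [hb]; ring
    rw [← ha, hb']
    have ha0 : 0 < a := by linarith
    have ha1 : a < 1 := by linarith
    have hb0 : 0 < b := by linarith
    have hb1 : b < 1 := by linarith
    rcases le_total a b with hab | hab <;> nlinarith
  have := (sq_lt_one_iff₀ (Dilation.ratio S₀).2).1 hρ
  exact_mod_cast this

end Inscribed

/-- The system `S₀` and the three homotheties at the vertices of `Δ`, with the vertices indexed
uniformly. -/
noncomputable def starSystem (p : Fin 3 → ℝ) (S₀ : ℂ →ᵈ ℂ) : Fin 4 → ℂ → ℂ :=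
  Fin.cons S₀ fun k => AffineMap.homothety (triangleVertex k) (p k)

theorem starSystem_unique_attractor_and_isDendrite {p : Fin 3 → ℝ} (hp0 : ∀ k, 0 < p k)
    (hp : ∑ k, p k < 1) {K' : Set ℂ}
    (hK' : IsAttractor (fun k => AffineMap.homothety (triangleVertex k) (p k)) K')
    {B : Fin 3 → ℂ} (hBK' : ∀ k, B k ∈ K') (hBk : ∀ k, baryCoord k (B k) = 1 - p k)
    {S₀ : ℂ →ᵈ ℂ} (hS₀ : ∀ k, S₀ (triangleVertex k) = B k) :
    (∃! K : Set ℂ, IsAttractor (starSystem p S₀) K) ∧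
      ∀ K : Set ℂ, IsAttractor (starSystem p S₀) K → IsDendrite K := by
  have hp1 : ∀ k, p k < 1 := fun k =>
    (Finset.single_le_sum (fun j _ => (hp0 j).le) (Finset.mem_univ k)).trans_lt hp
  -- A common Lipschitz constant for the homotheties.
  obtain ⟨q, hq0, hqp, hq1⟩ : ∃ q : ℝ≥0, 0 < q ∧ (∀ k, p k ≤ q) ∧ q < 1 := by
    refine ⟨⟨∑ k, p k, Finset.sum_nonneg fun k _ => (hp0 k).le⟩,
      Finset.sum_pos (fun k _ => hp0 k) Finset.univ_nonempty, fun k =>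
      Finset.single_le_sum (f := p) (fun j _ => (hp0 j).le) (Finset.mem_univ k), hp⟩
  have hhom : ∀ k, LipschitzWith q (AffineMap.homothety (triangleVertex k) (p k) : ℂ → ℂ) :=
    fun k => LipschitzWith.of_dist_le_mul fun x y => by
      rw [dist_homothety_apply _ (hp0 k).le]
      exact mul_le_mul_of_nonneg_right (hqp k) dist_nonneg
  have hne : triangle.Nonempty := ⟨_, triangleVertex_mem_triangle 0⟩
  have hmaps : ∀ k, MapsTo (AffineMap.homothety (triangleVertex k) (p k)) triangle triangle :=
    fun k => mapsTo_homothety_triangle k (hp0 k).le (hp1 k).le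
  have hK'Δ : K' ⊆ triangle := hK'.subset_of_mapsTo hhom hq1 isClosed_triangle hne hmaps
  have hB : ∀ k, B k ∈ triangle := fun k => hK'Δ (hBK' k)
  let ρ : Fin 4 → ℝ≥0 := Fin.cons (Dilation.ratio S₀) fun k => (p k).toNNReal
  let r : ℝ≥0 := max (Dilation.ratio S₀) q
  have hr : r < 1 := max_lt (dilation_ratio_lt_one hp0 hp hB hBk hS₀) hq1
  have hρ : ∀ i, ρ i ≠ 0 := Fin.cases (Dilation.ratio_ne_zero S₀) fun k =>
    (Real.toNNReal_pos.2 (hp0 k)).ne'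
  have hρr : ∀ i, ρ i ≤ r := Fin.cases (le_max_left _ _) fun k =>
    (Real.toNNReal_le_iff_le_coe.2 (hqp k)).trans (le_max_right _ _)
  have hdist : ∀ i x y, dist (starSystem p S₀ i x) (starSystem p S₀ i y) = ρ i * dist x y := by
    refine Fin.cases (fun x y => Dilation.dist_eq S₀ x y) fun k x y => ?_
    change _ = ((p k).toNNReal : ℝ) * _
    rw [Real.coe_toNNReal _ (hp0 k).le]
    exact dist_homothety_apply _ (hp0 k).le x y
  have hlip : ∀ i, LipschitzWith r (starSystem p S₀ i) := fun i =>
    LipschitzWith.of_dist_le_mul fun x y => by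
      rw [hdist]
      exact mul_le_mul_of_nonneg_right (hρr i) dist_nonneg
  refine ⟨?_, fun K hK => ?_⟩
  · obtain ⟨K, hK⟩ := exists_isAttractor hlip hr
    exact ⟨K, hK, fun L hL => hL.unique hK hlip hr⟩
  have hKΔ : K ⊆ triangle := hK.subset_of_mapsTo hlip hr isClosed_triangle hne
    (Fin.cases (mapsTo_triangle_of_vertices hB hS₀) hmaps)
  have hK'K : K' ⊆ K := hK'.subset_of_mapsTo hhom hq1 hK.2.1.isClosed hK.1 fun k =>
    hK.mapsTo k.succ
  -- `{A k}` is the attractor of the single homothety with centre `A k`.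
  have hA : ∀ k, triangleVertex k ∈ K := fun k => by
    have hfix : IsAttractor (fun _ : Unit => AffineMap.homothety (triangleVertex k) (p k))
        {triangleVertex k} := by
      refine ⟨singleton_nonempty _, isCompact_singleton, ?_⟩
      rw [iUnion_const, image_singleton, AffineMap.homothety_apply_same]
    exact singleton_subset_iff.1 (hfix.subset_of_mapsTo (fun _ => hhom k) hq1 hK.2.1.isClosed hK.1
      fun _ => hK.mapsTo k.succ)
  have hcorner : ∀ k, ∀ z ∈ starSystem p S₀ k.succ '' K, 1 - p k ≤ baryCoord k z := by
    rintro k _ ⟨z, hz, rfl⟩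
    change _ ≤ baryCoord k (AffineMap.homothety (triangleVertex k) (p k) z)
    rw [baryCoord_homothety, if_pos rfl]
    linarith [mul_nonneg (hp0 k).le (hKΔ hz k)]
  have hdisj : ∀ j k, j ≠ k → ∀ z ∈ triangle, 1 - p j ≤ baryCoord j z →
      1 - p k ≤ baryCoord k z → False := fun j k hjk z hz hj hk => by
    linarith [baryCoord_add_le hz hjk, ratio_add_lt_one hp0 hp hjk]
  -- `B k` lies in some piece of `K'`, and its `k`-th coordinate leaves only the `k`-th one.
  have hBS : ∀ k, B k ∈ starSystem p S₀ k.succ '' K := fun k => by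
    obtain ⟨j, x, hx, hxB⟩ := hK'.exists_mem_image (hBK' k)
    have hmem : B k ∈ starSystem p S₀ j.succ '' K := ⟨x, hK'K hx, hxB⟩
    by_cases hjk : j = k
    · exact hjk ▸ hmem
    · exact (hdisj j k hjk _ (hB k) (hcorner j _ hmem) (hBk k).ge).elim
  refine hK.isDendrite_of_star hρ hdist hρr hr 0 (Fin.cons 0 B) ?_ ?_
  · intro i hi
    obtain ⟨k, rfl⟩ := Fin.exists_succ_eq.2 hi
    refine Subset.antisymm ?_ (singleton_subset_iff.2 ⟨hBS k, triangleVertex k, hA k, hS₀ k⟩)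
    rintro _ ⟨hz, w, hw, rfl⟩
    rw [eq_triangleVertex_of_le_baryCoord hp0 hp hB hBk hS₀ (hKΔ hw) (hcorner k _ hz)]
    exact hS₀ k
  · intro i j hi hj hij
    obtain ⟨k, rfl⟩ := Fin.exists_succ_eq.2 hi
    obtain ⟨l, rfl⟩ := Fin.exists_succ_eq.2 hj
    refine disjoint_left.2 fun z hzk hzl => ?_
    have hzΔ : z ∈ triangle := by
      obtain ⟨w, hw, rfl⟩ := hzk
      exact hKΔ (hK.mapsTo _ hw)
    exact hdisj k l (fun h => hij (congrArg Fin.succ h)) z hzΔ (hcorner k z hzk) (hcorner l z hzl)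

/-- The point `B k` lies on the side of the corner triangle `S_k(Δ)` opposite to `A k`. -/
theorem baryCoord_of_mem_image_segment {k l : Fin 3} (hkl : k ≠ l) (p : Fin 3 → ℝ) {m n : Fin 3}
    (hm : k ≠ m) (hn : k ≠ n) {z : ℂ}
    (hz : z ∈ (AffineMap.homothety (triangleVertex k) (p k) ∘
      AffineMap.homothety (triangleVertex l) (p l) : ℂ → ℂ) ''
        segment ℝ (triangleVertex m) (triangleVertex n)) :
    baryCoord k z = 1 - p k := by
  obtain ⟨_, ⟨a, b, -, -, hab, rfl⟩, rfl⟩ := hz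
  have hx : baryCoord k (a • triangleVertex m + b • triangleVertex n) = 0 := by
    have hm0 := baryCoord_triangleVertex k m
    have hn0 := baryCoord_triangleVertex k n
    rw [if_neg hm] at hm0
    rw [if_neg hn] at hn0
    have : baryCoord k (a • triangleVertex m + b • triangleVertex n) =
        a * baryCoord k (triangleVertex m) + b * baryCoord k (triangleVertex n) := by
      fin_cases k <;> simp [baryCoord]
      · linear_combination -hab
      · ring
      · ring
    rw [this, hm0, hn0, mul_zero, mul_zero, add_zero]
  simp only [Function.comp_apply]
  rw [baryCoord_homothety, baryCoord_homothety, hx, if_neg hkl, if_pos rfl]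
  ring

theorem theorem2
    (p₁ p₂ p₃ : ℝ) (hp₁ : 0 < p₁) (hp₂ : 0 < p₂) (hp₃ : 0 < p₃) (hp : p₁ + p₂ + p₃ < 1)
    -- the Cantor set generated by `S₁, S₂, S₃`
    (K' : Set ℂ) (hK' : IsAttractor ![S₁ p₁, S₂ p₂, S₃ p₃] K')
    -- the vertices of the equilateral triangle `Δ₀`
    (B₁ B₂ B₃ : ℂ)
    (hB₁ : B₁ ∈ K' ∩ (S₁ p₁ ∘ S₂ p₂) '' segment ℝ A₂ A₃)
    (hB₂ : B₂ ∈ K' ∩ (S₂ p₂ ∘ S₃ p₃) '' segment ℝ A₁ A₃)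
    (hB₃ : B₃ ∈ K' ∩ (S₃ p₃ ∘ S₁ p₁) '' segment ℝ A₁ A₂)
    -- a similarity of the plane that maps `Δ` onto `Δ₀`
    (S₀ : ℂ →ᵈ ℂ) (h₁ : S₀ A₁ = B₁) (h₂ : S₀ A₂ = B₂) (h₃ : S₀ A₃ = B₃) :
    (∃! K : Set ℂ, IsAttractor ![S₀, S₁ p₁, S₂ p₂, S₃ p₃] K) ∧
      ∀ K : Set ℂ, IsAttractor ![S₀, S₁ p₁, S₂ p₂, S₃ p₃] K → IsDendrite K := by
  have hhom : (fun k => AffineMap.homothety (triangleVertex k) (![p₁, p₂, p₃] k) : Fin 3 → ℂ → ℂ) =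
      ![S₁ p₁, S₂ p₂, S₃ p₃] := by
    funext k
    fin_cases k <;> rfl
  have hstar : starSystem ![p₁, p₂, p₃] S₀ = (![S₀, S₁ p₁, S₂ p₂, S₃ p₃] : Fin 4 → ℂ → ℂ) := by
    funext i
    fin_cases i <;> rfl
  rw [← hstar]
  rw [← hhom] at hK'
  refine starSystem_unique_attractor_and_isDendrite (B := ![B₁, B₂, B₃]) ?_ ?_ hK' ?_ ?_ ?_
  · intro k
    fin_cases k
    exacts [hp₁, hp₂, hp₃]
  · simpa [Fin.sum_univ_three] using hp
  · intro k
    fin_cases k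
    exacts [hB₁.1, hB₂.1, hB₃.1]
  · intro k
    fin_cases k
    · exact baryCoord_of_mem_image_segment (k := 0) (l := 1) (m := 1) (n := 2) (by decide)
        ![p₁, p₂, p₃] (by decide) (by decide) hB₁.2
    · exact baryCoord_of_mem_image_segment (k := 1) (l := 2) (m := 0) (n := 2) (by decide)
        ![p₁, p₂, p₃] (by decide) (by decide) hB₂.2
    · exact baryCoord_of_mem_image_segment (k := 2) (l := 0) (m := 0) (n := 1) (by decide)
        ![p₁, p₂, p₃] (by decide) (by decide) hB₃.2
  · intro k
    fin_cases k
    exacts [h₁, h₂, h₃]
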